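/- Let $n,m\ge 2$. Let $\mathcal A=\ast_{x=1}^{n}\ell^\infty_m$ be the unital C*-algebra free product, amalgamated over the identity, of $n$ copies of $\ell^\infty_m=\mathbb C^m$, let $e_{a,x}\in\mathcal A$ be the $a$-th coordinate projection of the $x$-th copy of $\ell^\infty_m$, and let $\mathcal F_{n,m}=\operatorname{span}\{e_{a,x}:1\le a\le m,\ 1\le x\le n\}\subseteq\mathcal A$, an operator system with the matrix order inherited from $\mathcal A$. For operator systems $\mathcal S,\mathcal T$, the maximal tensor product $\mathcal S\otimes_{\max}\mathcal T$ is the vector space $\mathcal S\otimes\mathcal T$ with involution $(s\otimes t)^*=s^*\otimes t^*$ and unit $1\otimes 1$, in which a self-adjoint $X\in M_k(\mathcal S\otimes\mathcal T)$ is positive if and only if for every $\varepsilon>0$ there are $p,q$, $S\in M_p(\mathcal S)_+$, $T\in M_q(\mathcal T)_+$ and a linear map $A:\mathbb C^k\to\mathbb C^p\otimes\mathbb C^q$ with $X+\varepsilon I_k=A^*(S\otimes T)A$. A state is a unital positive linear functional. Let $C_{qmax}(n,m)$ be the set of all arrays $\big(s(e_{a,x}\otimes e_{b,y})\big)_{a,b,x,y}$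 $(1\le a,b\le m,\ 1\le x,y\le n)$, where $s$ runs over the states on $\mathcal F_{n,m}\otimes_{\max}\mathcal F_{n,m}$. Let $C_{nsb}(n,m)$ be the set of all real arrays $(p(a,b|x,y))_{a,b,x,y}$ such that 1. $p(a,b|x,y)\ge 0$ for all $a,b,x,y$; 2. $\sum_{a,b=1}^m p(a,b|x,y)=1$ for all $x,y$; 3. $\sum_{a=1}^m p(a,b|x,y)=\sum_{a=1}^m p(a,b|x',y)$ for all $b,x,x',y$; 4. $\sum_{b=1}^m p(a,b|x,y)=\sum_{b=1}^m p(a,b|x,y')$ for all $a,x,y,y'$. Then $C_{qmax}(n,m)=C_{nsb}(n,m)$. -/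

import Mathlib

open scoped TensorProduct ENNReal ComplexOrder

/-! ### Operator systems and their maximal tensor product -/

/-- The matrix-order data of an operator system on a complex vector space `V`: its order unit and
its cones of positive elements in `M_k(V)`. -/
structure MatrixOrder (V : Type*) where
  /-- the order unit -/
  unit : V
  /-- the cone `M_k(V)_+` -/
  pos : ∀ k : ℕ, Set (Matrix (Fin k) (Fin k) V)

/-- A state: a linear functional which is unital and positive, i.e. takes nonnegative real values
on the positive elements of `V = M_1(V)`. -/
def MatrixOrder.IsState {V : Type*} [AddCommGroup V] [Module ℂ V] (P : MatrixOrder V)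
    (s : V →ₗ[ℂ] ℂ) : Prop :=
  s P.unit = 1 ∧ ∀ v : V, (Matrix.of fun _ _ => v) ∈ P.pos 1 → 0 ≤ s v

/-- The maximal tensor product. The unit is `1 ⊗ 1`, and a self-adjoint `X` in `M_k(V ⊗ W)` is
positive if and only if for every `ε > 0` there are `S` in `M_p(V)_+`, `T` in `M_q(W)_+` and a
scalar matrix `A : ℂ^k → ℂ^p ⊗ ℂ^q` with `X + ε I_k = A^* (S ⊗ T) A`. The last equation is written
entrywise. -/
noncomputable def MatrixOrder.maxTensor {V W : Type*}
    [AddCommGroup V] [Module ℂ V] [StarAddMonoid V] [StarModule ℂ V]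
    [AddCommGroup W] [Module ℂ W] [StarAddMonoid W] [StarModule ℂ W]
    (P : MatrixOrder V) (Q : MatrixOrder W) : MatrixOrder (V ⊗[ℂ] W) where
  unit := P.unit ⊗ₜ[ℂ] Q.unit
  pos k := {X | X.IsHermitian ∧ ∀ ε : ℝ, 0 < ε →
    ∃ (p q : ℕ) (S : Matrix (Fin p) (Fin p) V) (T : Matrix (Fin q) (Fin q) W)
      (A : Matrix (Fin p × Fin q) (Fin k) ℂ), S ∈ P.pos p ∧ T ∈ Q.pos q ∧
      ∀ i j : Fin k,
        X i j + (if i = j then (ε : ℂ) • (P.unit ⊗ₜ[ℂ] Q.unit) else 0) =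
          ∑ r : Fin p × Fin q, ∑ t : Fin p × Fin q,
            (star (A r i) * A t j) • (S r.1 t.1 ⊗ₜ[ℂ] T r.2 t.2)}

/-- A (concrete) operator system: a unital self-adjoint subspace of a unital C*-algebra. -/
structure OperatorSystem (A : Type*) [CStarAlgebra A] where
  /-- the underlying subspace -/
  carrier : Submodule ℂ A
  one_mem : (1 : A) ∈ carrier
  star_mem : ∀ {a : A}, a ∈ carrier → star a ∈ carrier

namespace OperatorSystem

variable {A : Type*} [CStarAlgebra A] (S : OperatorSystem A)

instance : StarAddMonoid S.carrier where
  star a := ⟨star (a : A), S.star_mem a.2⟩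
  star_involutive a := Subtype.ext (star_star (a : A))
  star_add a b := Subtype.ext (star_add (a : A) (b : A))

instance : StarModule ℂ S.carrier where
  star_smul c a := Subtype.ext (star_smul c (a : A))

/-- The matrix order of an operator system: a matrix over it is positive when it is a positive
element of the C*-algebra `M_k(A)`, i.e. of the form `Y^* Y` with `Y` in `M_k(A)`. -/
def matrixOrder : MatrixOrder S.carrier where
  unit := ⟨1, S.one_mem⟩
  pos k := {X | ∃ Y : Matrix (Fin k) (Fin k) A, X.map (fun a => (a : A)) = Y.conjTranspose * Y}

end OperatorSystem

/-! ### The unital free product of C*-algebras -/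

/-- A family of unital `*`-homomorphisms from the C*-algebras `B i` into the bounded operators on
one common nonzero Hilbert space. -/
structure JointRep {ι : Type} (B : ι → Type) [∀ i, CStarAlgebra (B i)] : Type 1 where
  /-- the Hilbert space -/
  H : Type
  [normed : NormedAddCommGroup H]
  [inner : InnerProductSpace ℂ H]
  [complete : CompleteSpace H]
  [nontrivial : Nontrivial H]
  /-- the representations -/
  rep : ∀ i, B i →⋆ₐ[ℂ] (H →L[ℂ] H)

attribute [instance] JointRep.normed JointRep.inner JointRep.complete JointRep.nontrivial

namespace FreeProduct

variable {ι : Type} (B : ι → Type) [∀ i, CStarAlgebra (B i)]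

/-- The bounded (block-diagonal) operators `∏ π, B(H_π)` on the Hilbert spaces of all joint
representations of the family `B`, with the supremum norm. -/
abbrev Ambient : Type 1 := lp (fun π : JointRep B => π.H →L[ℂ] π.H) ∞

noncomputable instance : CStarAlgebra (Ambient B) where

/-- `b` in `B i` acts in every joint representation `π` as `π_i(b)`. -/
noncomputable def embAmbient (i : ι) : B i →⋆ₐ[ℂ] Ambient B where
  toFun b := ⟨fun π => π.rep i b, memℓp_infty ⟨‖b‖, by
    rintro _ ⟨π, rfl⟩
    exact NonUnitalStarAlgHom.norm_apply_le (π.rep i) b⟩⟩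
  map_one' := Subtype.ext (funext fun π => map_one (π.rep i))
  map_mul' b c := Subtype.ext (funext fun π => map_mul (π.rep i) b c)
  map_zero' := Subtype.ext (funext fun π => map_zero (π.rep i))
  map_add' b c := Subtype.ext (funext fun π => map_add (π.rep i) b c)
  commutes' c := Subtype.ext (funext fun π => AlgHomClass.commutes (π.rep i) c)
  map_star' b := Subtype.ext (funext fun π => map_star (π.rep i) b)

/-- The C*-algebra generated by the images of all the `B i` in the direct sum of all joint
representations. -/
noncomputable def alg : StarSubalgebra ℂ (Ambient B) :=
  (StarAlgebra.adjoin ℂ {a | ∃ (i : ι) (b : B i), a = embAmbient B i b}).topologicalClosure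

instance : IsClosed (alg B : Set (Ambient B)) := StarSubalgebra.isClosed_topologicalClosure _

end FreeProduct

/-- The free product of the unital C*-algebras `B i`, amalgamated over the identity. -/
def FreeProduct {ι : Type} (B : ι → Type) [∀ i, CStarAlgebra (B i)] : Type 1 := FreeProduct.alg B

noncomputable instance {ι : Type} (B : ι → Type) [∀ i, CStarAlgebra (B i)] :
    CStarAlgebra (FreeProduct B) :=
  inferInstanceAs (CStarAlgebra (FreeProduct.alg B))

/-- The canonical unital `*`-homomorphism of the `i`-th factor into the free product. -/
noncomputable def FreeProduct.emb {ι : Type} (B : ι → Type) [∀ i, CStarAlgebra (B i)] (i : ι) :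
    B i →⋆ₐ[ℂ] FreeProduct B :=
  StarAlgHom.codRestrict (FreeProduct.embAmbient B i) (FreeProduct.alg B) fun b =>
    StarSubalgebra.le_topologicalClosure _ (StarAlgebra.subset_adjoin ℂ _ ⟨i, b, rfl⟩)

/-! ### The operator system `F_{n,m}` and the correlation sets -/

/-- The free product, amalgamated over the identity, of `n` copies of `ℓ^∞_m = ℂ^m`. -/
abbrev FreeCube (n m : ℕ) : Type 1 := FreeProduct fun _ : Fin n => Fin m → ℂ

/-- The generator `e_{a,x}`: the `a`-th coordinate projection of the `x`-th copy of `ℓ^∞_m`. -/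
noncomputable def cubeGen {n m : ℕ} (a : Fin m) (x : Fin n) : FreeCube n m :=
  FreeProduct.emb (fun _ : Fin n => Fin m → ℂ) x (Pi.single a 1)

theorem star_cubeGen {n m : ℕ} (a : Fin m) (x : Fin n) :
    star (cubeGen a x : FreeCube n m) = cubeGen a x := by
  rw [cubeGen, ← map_star, ← Pi.single_star, star_one]

theorem sum_cubeGen {n m : ℕ} (x : Fin n) : ∑ a : Fin m, (cubeGen a x : FreeCube n m) = 1 := by
  have h : (∑ a : Fin m, (Pi.single a 1 : Fin m → ℂ)) = 1 := by
    ext j; simp [Finset.sum_apply, Pi.single_apply]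
  simp only [cubeGen]
  rw [← map_sum, h, map_one]

/-- `F_{n,m}`, the span of the generators `e_{a,x}` in the free product. (Over an empty index set
of copies the span would not contain the identity, hence `0 < n`.) -/
noncomputable def cubeSystem (n m : ℕ) (hn : 0 < n) : OperatorSystem (FreeCube n m) where
  carrier := Submodule.span ℂ {u | ∃ (a : Fin m) (x : Fin n), u = cubeGen a x}
  one_mem := by
    rw [← sum_cubeGen (⟨0, hn⟩ : Fin n)]
    exact Submodule.sum_mem _ fun a _ => Submodule.subset_span ⟨a, _, rfl⟩
  star_mem := by
    intro u hu
    induction hu using Submodule.span_induction with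
    | mem u h =>
      obtain ⟨a, x, rfl⟩ := h
      rw [star_cubeGen]
      exact Submodule.subset_span ⟨a, x, rfl⟩
    | zero => rw [star_zero]; exact Submodule.zero_mem _
    | add u v _ _ hu hv => rw [star_add]; exact Submodule.add_mem _ hu hv
    | smul c u _ hu => rw [star_smul]; exact Submodule.smul_mem _ _ hu

/-- `e_{a,x}` as an element of `F_{n,m}`. -/
noncomputable def cubeSystem.gen {n m : ℕ} (hn : 0 < n) (a : Fin m) (x : Fin n) :
    (cubeSystem n m hn).carrier :=
  ⟨cubeGen a x, Submodule.subset_span ⟨a, x, rfl⟩⟩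

/-- `C_qmax(n,m)`: all arrays `(s(e_{a,x} ⊗ f_{b,y}))`, indexed by `a b x y`, where `s` is a state
on `F_{n,m} ⊗_max F_{n,m}`. -/
def Cqmax (n m : ℕ) (hn : 0 < n) : Set (Fin m → Fin m → Fin n → Fin n → ℂ) :=
  {c | ∃ s : (cubeSystem n m hn).carrier ⊗[ℂ] (cubeSystem n m hn).carrier →ₗ[ℂ] ℂ,
    ((cubeSystem n m hn).matrixOrder.maxTensor (cubeSystem n m hn).matrixOrder).IsState s ∧
    c = fun a b x y => s (cubeSystem.gen hn a x ⊗ₜ[ℂ] cubeSystem.gen hn b y)}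

/-- `C_nsb(n,m)`: the non-signalling box probabilities; `p a b x y` stands for `p(a,b|x,y)`. -/
def Cnsb (n m : ℕ) : Set (Fin m → Fin m → Fin n → Fin n → ℝ) :=
  {p | (∀ a b x y, 0 ≤ p a b x y) ∧
    (∀ x y, ∑ a, ∑ b, p a b x y = 1) ∧
    (∀ b x x' y, ∑ a, p a b x y = ∑ a, p a b x' y) ∧
    (∀ a x y y', ∑ b, p a b x y = ∑ b, p a b x y')}

/-! Both inclusions rest on how little structure `F_{n,m}` has. Its generators obey only the linear
relations saying that `∑ a, e_{a,x}` does not depend on `x`, so non-signalling arrays are exactly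
the value tables of bilinear forms on it (`exists_linearMap`, used once in each slot).

For positivity, a linear map into matrices that is positive on the generators is completely positive
(`sum_dotProduct_nonneg`): the images `F a x` have the same sum over `a` for every `x`, so
`exists_dilation` compresses one representation of the free product to all of them. Applying this to
one tensor factor and then to the other shows that a bilinear form nonnegative on pairs of
generators is nonnegative on every `A^* (S ⊗ T) A`, hence on the maximal cone. Conversely `e_{a,x} ⊗
e_{b,y}` lies in that cone, so a state yields a nonnegative array, and the relations among
generators give normalization and non-signalling. -/

open scoped InnerProductSpace

/-- Two linear maps into a finite-dimensional inner product space with pointwise equal norms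
differ by a unitary. -/
theorem LinearMap.exists_linearIsometryEquiv_of_norm_eq {M E : Type*} [AddCommGroup M] [Module ℂ M]
    [NormedAddCommGroup E] [InnerProductSpace ℂ E] [FiniteDimensional ℂ E]
    (f g : M →ₗ[ℂ] E) (h : ∀ v, ‖f v‖ = ‖g v‖) :
    ∃ U : E ≃ₗᵢ[ℂ] E, ∀ v, U (f v) = g v := by
  obtain ⟨r, hr⟩ := f.rangeRestrict.exists_rightInverse_of_surjective f.range_rangeRestrict
  have hr' : ∀ u, f (r u) = u := fun u => congrArg Subtype.val (LinearMap.congr_fun hr u)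
  -- Equal norms force `ker f ≤ ker g`, so `g ∘ₗ r` does not depend on the section `r`; the
  -- resulting isometry on `range f` extends to a unitary because `E` is finite-dimensional.
  let L : LinearMap.range f →ₗᵢ[ℂ] E :=
    ⟨g ∘ₗ r, fun u => by rw [LinearMap.comp_apply, ← h, hr']; rfl⟩
  refine ⟨L.extend.toLinearIsometryEquiv rfl, fun v => ?_⟩
  have h1 : L.extend (f v) = L ⟨f v, v, rfl⟩ := L.extend_apply ⟨f v, v, rfl⟩
  rw [LinearIsometry.toLinearIsometryEquiv_apply, h1]
  change g (r ⟨f v, v, rfl⟩) = g v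
  rw [← sub_eq_zero, ← map_sub, ← norm_eq_zero, ← h, map_sub, hr', sub_self, norm_zero]

/-! ### Representations of the free product -/

namespace FreeProduct

variable {ι : Type} {B : ι → Type} [∀ i, CStarAlgebra (B i)]

/-- The representation of the free product induced by a joint representation of the factors. -/
noncomputable def lift (π : JointRep B) : FreeProduct B →⋆ₐ[ℂ] (π.H →L[ℂ] π.H) where
  toFun u := (u.1 : Ambient B) π
  map_one' := rfl
  map_mul' _ _ := rfl
  map_zero' := rfl
  map_add' _ _ := rfl
  commutes' _ := rfl
  map_star' _ := rfl

theorem lift_emb (π : JointRep B) (i : ι) (b : B i) : lift π (emb B i b) = π.rep i b := rfl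

end FreeProduct

/-! ### Simultaneous Naimark dilation -/

section Dilation

variable {m : ℕ} {κ : Type} [Fintype κ]

/-- The representation of `ℂ^m` on `ℂ^m ⊗ ℂ^κ` by multiplication operators. -/
noncomputable def diagonalRep (m : ℕ) (κ : Type) [Fintype κ] [DecidableEq κ] :
    (Fin m → ℂ) →⋆ₐ[ℂ] (EuclideanSpace ℂ (Fin m × κ) →L[ℂ] EuclideanSpace ℂ (Fin m × κ)) :=
  (Matrix.toEuclideanCLM (n := Fin m × κ) (𝕜 := ℂ) : _ →⋆ₐ[ℂ] _).comp
    { toFun := fun z => Matrix.diagonal fun q : Fin m × κ => z q.1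
      map_one' := Matrix.diagonal_one
      map_mul' := fun _ _ => (Matrix.diagonal_mul_diagonal _ _).symm
      map_zero' := Matrix.diagonal_zero
      map_add' := fun _ _ => (Matrix.diagonal_add _ _).symm
      commutes' := fun _ => rfl
      map_star' := fun _ => (Matrix.diagonal_conjTranspose _).symm }

theorem diagonalRep_apply [DecidableEq κ] (z : Fin m → ℂ)
    (v : EuclideanSpace ℂ (Fin m × κ)) (q : Fin m × κ) :
    diagonalRep m κ z v q = z q.1 * v q := by
  change (Matrix.toEuclideanCLM (n := Fin m × κ) (𝕜 := ℂ) (Matrix.diagonal fun q => z q.1) v) q = _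
  rw [Matrix.ofLp_toEuclideanCLM, Matrix.mulVec_diagonal]

/-- The column map `v ↦ (B_a v)_a`. -/
noncomputable def columnMap (B : Fin m → Matrix κ κ ℂ) :
    (κ → ℂ) →ₗ[ℂ] EuclideanSpace ℂ (Fin m × κ) :=
  (WithLp.linearEquiv 2 ℂ (Fin m × κ → ℂ)).symm.toLinearMap ∘ₗ
    (Matrix.of fun (q : Fin m × κ) l => B q.1 q.2 l).mulVecLin

theorem columnMap_apply (B : Fin m → Matrix κ κ ℂ) (v : κ → ℂ) (q : Fin m × κ) :
    columnMap B v q = (B q.1).mulVec v q.2 := rfl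

/-- Used twice: `z = 1` shows that the norm of the column depends only on the sum of the `B_a^*
B_a`, and `z = Pi.single a 1` recovers the single term `B_a^* B_a` as a compression. -/
theorem inner_columnMap_diagonalRep [DecidableEq κ] (B : Fin m → Matrix κ κ ℂ)
    (z : Fin m → ℂ) (u v : κ → ℂ) :
    ⟪columnMap B u, diagonalRep m κ z (columnMap B v)⟫_ℂ =
      ∑ a, z a * (star u ⬝ᵥ ((B a).conjTranspose * B a).mulVec v) := by
  rw [PiLp.inner_apply, Fintype.sum_prod_type]
  refine Finset.sum_congr rfl fun a _ => ?_
  rw [← Matrix.mulVec_mulVec, Matrix.dotProduct_mulVec, ← Matrix.star_mulVec, dotProduct,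
    Finset.mul_sum]
  refine Finset.sum_congr rfl fun k _ => ?_
  rw [diagonalRep_apply, columnMap_apply, columnMap_apply, RCLike.inner_apply, Pi.star_apply,
    ← starRingEnd_apply]
  ring

open scoped MatrixOrder Matrix.Norms.L2Operator in
/-- Simultaneous Naimark dilation: finitely many families of positive matrices with the same sum
are compressions of coordinate projections under one representation of the free product. -/
theorem exists_dilation {n : ℕ} [DecidableEq κ] [Nonempty κ] (hn : 0 < n) (hm : 0 < m)
    (F : Fin m → Fin n → Matrix κ κ ℂ) (hF : ∀ a x, (F a x).PosSemidef)
    (hsum : ∀ x x', ∑ a, F a x = ∑ a, F a x') :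
    ∃ (H : Type) (_ : NormedAddCommGroup H) (_ : InnerProductSpace ℂ H) (_ : CompleteSpace H)
      (π : FreeCube n m →⋆ₐ[ℂ] (H →L[ℂ] H)) (V : (κ → ℂ) →ₗ[ℂ] H),
      ∀ a x u v, ⟪V u, π (cubeGen a x) (V v)⟫_ℂ = star u ⬝ᵥ (F a x).mulVec v := by
  have hB : ∀ a x, ∃ B : Matrix κ κ ℂ, F a x = B.conjTranspose * B := fun a x =>
    CStarAlgebra.nonneg_iff_eq_star_mul_self.mp (hF a x).nonneg
  choose B hB using hB
  let x₀ : Fin n := ⟨0, hn⟩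
  have hnorm : ∀ x v, ‖columnMap (fun a => B a x₀) v‖ = ‖columnMap (fun a => B a x) v‖ := by
    have key : ∀ x v, ⟪columnMap (fun a => B a x) v, columnMap (fun a => B a x) v⟫_ℂ =
        star v ⬝ᵥ (∑ a, F a x).mulVec v := by
      intro x v
      have := inner_columnMap_diagonalRep (fun a => B a x) 1 v v
      rw [map_one, one_apply_eq_self] at this
      rw [this, Matrix.sum_mulVec, dotProduct_sum]
      simp only [Pi.one_apply, one_mul, hB]
    intro x v
    have h := key x₀ v
    rw [hsum x₀ x, ← key x v, inner_self_eq_norm_sq_to_K, inner_self_eq_norm_sq_to_K] at h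
    exact (sq_eq_sq₀ (norm_nonneg _) (norm_nonneg _)).mp (by exact_mod_cast h)
  -- Conjugating the `x`-th diagonal representation by `U x` lets the single column map at `x₀`
  -- serve as `V` for every `x`.
  choose U hU using fun x => LinearMap.exists_linearIsometryEquiv_of_norm_eq _ _ (hnorm x)
  -- A `JointRep` must act on a nonzero Hilbert space.
  have : Nonempty (Fin m × κ) := ⟨(⟨0, hm⟩, Classical.arbitrary κ)⟩
  let ρ : JointRep (fun _ : Fin n => Fin m → ℂ) :=
    { H := EuclideanSpace ℂ (Fin m × κ)
      rep := fun x => ((U x).symm.conjStarAlgEquiv : _ →⋆ₐ[ℂ] _).comp (diagonalRep m κ) }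
  refine ⟨ρ.H, _, _, inferInstance, FreeProduct.lift ρ, columnMap fun a => B a x₀,
    fun a x u v => ?_⟩
  rw [cubeGen, FreeProduct.lift_emb]
  change ⟪columnMap (fun a => B a x₀) u, (U x).symm (diagonalRep m κ (Pi.single a 1)
    (U x (columnMap (fun a => B a x₀) v)))⟫_ℂ = _
  rw [← (U x).inner_map_map, (U x).apply_symm_apply, hU, hU, inner_columnMap_diagonalRep]
  simp [Pi.single_apply, hB]

end Dilation

theorem Matrix.PosSemidef.of_forall_nonneg {κ : Type*} [Fintype κ] [DecidableEq κ]
    {M : Matrix κ κ ℂ} (h : ∀ v : κ → ℂ, 0 ≤ star v ⬝ᵥ M.mulVec v) : M.PosSemidef := by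
  rw [← Matrix.isPositive_toEuclideanLin_iff, LinearMap.isPositive_iff_complex]
  intro x
  have h' : 0 ≤ ⟪M.toEuclideanLin x, x⟫_ℂ := by
    rw [← inner_conj_symm, EuclideanSpace.inner_eq_star_dotProduct, dotProduct_comm,
      starRingEnd_apply, star_nonneg_iff]
    exact h x.ofLp
  obtain ⟨h1, h2⟩ := Complex.nonneg_iff.mp h'
  exact ⟨Complex.ext rfl h2, h1⟩

theorem Complex.nonneg_of_forall_pos_add {z : ℂ} (h : ∀ ε : ℝ, 0 < ε → 0 ≤ z + ε) : 0 ≤ z := by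
  have h' : ∀ ε : ℝ, 0 < ε → 0 ≤ z.re + ε ∧ 0 = z.im := fun ε hε => by
    simpa using Complex.nonneg_iff.mp (h ε hε)
  exact Complex.nonneg_iff.mpr
    ⟨le_of_forall_pos_le_add fun ε hε => (h' ε hε).1, (h' 1 one_pos).2⟩

/-! ### Linear and completely positive maps out of `F_{n,m}` -/

namespace cubeSystem

variable {n m : ℕ} (hn : 0 < n)

theorem sum_gen (x : Fin n) : ∑ a : Fin m, gen hn a x = (cubeSystem n m hn).matrixOrder.unit := by
  apply Subtype.ext
  rw [AddSubmonoidClass.coe_finsetSum]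
  exact sum_cubeGen x

theorem star_gen (a : Fin m) (x : Fin n) : star (gen hn a x) = gen hn a x :=
  Subtype.ext (star_cubeGen a x)

theorem span_gen :
    Submodule.span ℂ (Set.range fun q : Fin m × Fin n => gen hn q.1 q.2) = ⊤ := by
  rw [eq_top_iff]
  rintro ⟨u, hu⟩ -
  induction hu using Submodule.span_induction with
  | mem u h =>
    obtain ⟨a, x, rfl⟩ := h
    exact Submodule.subset_span ⟨(a, x), rfl⟩
  | zero => exact Submodule.zero_mem _
  | add u v hu hv hu' hv' => exact Submodule.add_mem _ hu' hv'
  | smul c u _ hu' => exact Submodule.smul_mem _ c hu'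

variable {W : Type*} [AddCommGroup W] [Module ℂ W]

theorem linearMap_ext {f g : (cubeSystem n m hn).carrier →ₗ[ℂ] W}
    (h : ∀ a x, f (gen hn a x) = g (gen hn a x)) : f = g :=
  LinearMap.ext_on_range (span_gen hn) fun q => h q.1 q.2

variable (hm : 0 < m)
include hm

/-- Linear maps on the operator system that are positive on the generators are completely
positive. -/
theorem sum_dotProduct_nonneg {κ : Type} [Fintype κ] [DecidableEq κ]
    (Φ : (cubeSystem n m hn).carrier →ₗ[ℂ] Matrix κ κ ℂ)
    (hΦ : ∀ a x, (Φ (gen hn a x)).PosSemidef) {p : ℕ}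
    {S : Matrix (Fin p) (Fin p) (cubeSystem n m hn).carrier}
    (hS : S ∈ (cubeSystem n m hn).matrixOrder.pos p) (v : Fin p → κ → ℂ) :
    0 ≤ ∑ i, ∑ j, star (v i) ⬝ᵥ (Φ (S i j)).mulVec (v j) := by
  cases isEmpty_or_nonempty κ
  · simp [dotProduct]
  obtain ⟨H, _, _, _, π, V, hV⟩ := exists_dilation hn hm (fun a x => Φ (gen hn a x)) hΦ
    fun x x' => by simp_rw [← map_sum, sum_gen]
  have hV' : ∀ w u v, ⟪V u, π w.1 (V v)⟫_ℂ = star u ⬝ᵥ (Φ w).mulVec v := by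
    intro w u v
    have hw : w ∈ Submodule.span ℂ (Set.range fun q : Fin m × Fin n => gen hn q.1 q.2) := by
      rw [span_gen]; trivial
    induction hw using Submodule.span_induction with
    | mem w h => obtain ⟨q, rfl⟩ := h; exact hV _ _ _ _
    | zero => simp
    | add w w' _ _ h h' =>
      rw [Submodule.coe_add, map_add, add_apply, inner_add_right, h, h', map_add,
        Matrix.add_mulVec, dotProduct_add]
    | smul c w _ h =>
      rw [Submodule.coe_smul, map_smul, smul_apply, inner_smul_right, h,
        map_smul, Matrix.smul_mulVec, dotProduct_smul, smul_eq_mul]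
  obtain ⟨Y, hY⟩ := hS
  have hS' : ∀ i j, (S i j).1 = ∑ k, star (Y k i) * Y k j := fun i j =>
    congrFun (congrFun hY i) j
  -- With `S = Y^* Y` and `Φ` a compression of `π`, the form becomes a sum of squared norms.
  have key : ∑ i, ∑ j, star (v i) ⬝ᵥ (Φ (S i j)).mulVec (v j) =
      ∑ k, ⟪∑ i, π (Y k i) (V (v i)), ∑ i, π (Y k i) (V (v i))⟫_ℂ := by
    simp_rw [← hV', hS', map_sum, _root_.sum_apply, inner_sum, sum_inner, map_mul,
      map_star, ContinuousLinearMap.star_eq_adjoint, mul_apply_eq_comp,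
      ContinuousLinearMap.adjoint_inner_right]
    rw [Finset.sum_comm_cycle]
    exact Finset.sum_congr rfl fun _ _ => Finset.sum_comm
  rw [key]
  exact Finset.sum_nonneg fun k _ =>
    Complex.nonneg_iff.mpr ⟨inner_self_nonneg (𝕜 := ℂ), (inner_self_im (𝕜 := ℂ) _).symm⟩

/-- The deterministic functionals. -/
theorem exists_indicator (g : Fin n → Fin m) :
    ∃ δ : (cubeSystem n m hn).carrier →ₗ[ℂ] ℂ,
      ∀ a x, δ (gen hn a x) = if a = g x then 1 else 0 := by
  obtain ⟨H, _, _, _, π, V, hV⟩ := exists_dilation (κ := Unit) hn hm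
    (fun a x => if a = g x then 1 else 0)
    (fun a x => by split_ifs; exacts [Matrix.PosSemidef.one, Matrix.PosSemidef.zero])
    fun x x' => by simp
  refine ⟨
    { toFun := fun w => ⟪V 1, π w.1 (V 1)⟫_ℂ
      map_add' := fun w w' => by rw [Submodule.coe_add, map_add, add_apply, inner_add_right]
      map_smul' := fun c w => by
        rw [Submodule.coe_smul, map_smul, smul_apply, inner_smul_right]; rfl },
    fun a x => ?_⟩
  refine (hV a x 1 1).trans ?_
  split_ifs <;> simp [dotProduct]

/-- The deterministic functionals separate the generators well enough to interpolate any table whose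
column sums agree; no further linear relation can obstruct this. -/
theorem exists_linearMap (w : Fin m → Fin n → W) (hw : ∀ x x', ∑ a, w a x = ∑ a, w a x') :
    ∃ f : (cubeSystem n m hn).carrier →ₗ[ℂ] W, ∀ a x, f (gen hn a x) = w a x := by
  choose δ hδ using exists_indicator (n := n) (m := m) hn hm
  let a₀ : Fin m := ⟨0, hm⟩
  let g₀ : Fin n → Fin m := fun _ => a₀
  -- At `gen a' x'` the double sum gives `w a' x'`, minus `∑ a, w a x'` when `a' = a₀`; the first
  -- summand cancels this defect, as the column sums coincide.
  refine ⟨(δ g₀).smulRight (∑ a, w a ⟨0, hn⟩) +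
    ∑ x, ∑ a, (δ (Function.update g₀ x a) - δ g₀).smulRight (w a x), fun a' x' => ?_⟩
  have h1 : ∀ x a, δ (Function.update g₀ x a) (gen hn a' x') - δ g₀ (gen hn a' x') =
      if x = x' then (if a' = a then 1 else 0) - (if a' = a₀ then 1 else 0) else 0 := by
    intro x a
    rw [hδ, hδ]
    by_cases hx : x = x'
    · subst hx; simp [g₀]
    · simp [hx, Function.update_of_ne (Ne.symm hx)]
  simp only [LinearMap.add_apply, LinearMap.sum_apply, LinearMap.smulRight_apply,
    LinearMap.sub_apply, h1, ite_smul, zero_smul, sub_smul]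
  rw [hδ]
  simp [g₀, hw x' ⟨0, hn⟩, Finset.sum_ite_irrel]

end cubeSystem

/-! ### Positivity on the maximal tensor product -/

namespace cubeSystem

variable {n m : ℕ} (hn : 0 < n)

/-- The extra entry `1` supplies the `1 ⊗ 1` needed to absorb `ε` in the maximal cone. -/
theorem diagonal_gen_unit_mem_pos (a : Fin m) (x : Fin n) :
    Matrix.diagonal ![gen hn a x, (cubeSystem n m hn).matrixOrder.unit] ∈
      (cubeSystem n m hn).matrixOrder.pos 2 := by
  have hidem : (cubeGen a x : FreeCube n m) * cubeGen a x = cubeGen a x := by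
    rw [cubeGen, ← map_mul, ← Pi.single_mul, mul_one]
  refine ⟨Matrix.diagonal ![cubeGen a x, 1], ?_⟩
  rw [Matrix.diagonal_conjTranspose, Matrix.diagonal_mul_diagonal, Matrix.diagonal_map rfl]
  congr 1
  funext i
  fin_cases i
  · simp [star_cubeGen, hidem, gen]
  · simp [OperatorSystem.matrixOrder]

theorem gen_tmul_gen_mem_pos (a b : Fin m) (x y : Fin n) :
    (Matrix.of fun _ _ => gen hn a x ⊗ₜ[ℂ] gen hn b y) ∈
      ((cubeSystem n m hn).matrixOrder.maxTensor (cubeSystem n m hn).matrixOrder).pos 1 := by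
  -- The column `A` selects `e_{a,x} ⊗ e_{b,y}` at `(0, 0)` with weight `1` and `1 ⊗ 1` at `(1, 1)`
  -- with weight `√ε`.
  refine ⟨?_, fun ε hε => ⟨2, 2, _, _,
    Matrix.of fun r _ => if r = (0, 0) then 1 else if r = (1, 1) then (Real.sqrt ε : ℂ) else 0,
    diagonal_gen_unit_mem_pos hn a x, diagonal_gen_unit_mem_pos hn b y, fun i j => ?_⟩⟩
  · ext i j
    simp [TensorProduct.star_tmul, star_gen]
  · have h : (Real.sqrt ε : ℂ) * Real.sqrt ε = ε := by
      rw [← Complex.ofReal_mul, Real.mul_self_sqrt hε.le]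
    simp [Fintype.sum_prod_type, Fin.sum_univ_two, Subsingleton.elim i j, h, Prod.ext_iff]

variable (hm : 0 < m)
include hm

/-- A bilinear form that is nonnegative on pairs of generators is a positive functional on the
maximal tensor product. -/
theorem lift_nonneg
    (K : (cubeSystem n m hn).carrier →ₗ[ℂ] (cubeSystem n m hn).carrier →ₗ[ℂ] ℂ)
    (hK : ∀ a b x y, 0 ≤ K (gen hn a x) (gen hn b y))
    (hunit : K (cubeSystem n m hn).matrixOrder.unit (cubeSystem n m hn).matrixOrder.unit = 1)
    {X : (cubeSystem n m hn).carrier ⊗[ℂ] (cubeSystem n m hn).carrier}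
    (hX : (Matrix.of fun _ _ => X) ∈
      ((cubeSystem n m hn).matrixOrder.maxTensor (cubeSystem n m hn).matrixOrder).pos 1) :
    0 ≤ TensorProduct.lift K X := by
  refine Complex.nonneg_of_forall_pos_add fun ε hε => ?_
  obtain ⟨p, q, S, T, A, hS, hT, h⟩ := hX.2 ε hε
  -- Fixing `S` turns `K` into a matrix-valued map of the second slot. It is positive on generators
  -- by complete positivity of the scalar slices `K · (gen hn b y)`; complete positivity of `Ψ`
  -- itself then handles `T`.
  let Ψ : (cubeSystem n m hn).carrier →ₗ[ℂ] Matrix (Fin p) (Fin p) ℂ :=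
    { toFun := fun w => Matrix.of fun i j => K (S i j) w
      map_add' := fun w w' => by ext; simp
      map_smul' := fun c w => by ext; simp }
  have hΨ : ∀ b y, (Ψ (gen hn b y)).PosSemidef := by
    refine fun b y => Matrix.PosSemidef.of_forall_nonneg fun v => ?_
    let φ : (cubeSystem n m hn).carrier →ₗ[ℂ] Matrix Unit Unit ℂ :=
      { toFun := fun w => Matrix.of fun _ _ => K w (gen hn b y)
        map_add' := fun w w' => by ext; simp
        map_smul' := fun c w => by ext; simp }
    have := sum_dotProduct_nonneg hn hm φ (fun a x => Matrix.PosSemidef.of_forall_nonneg fun v => by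
      have := mul_nonneg (hK a b x y) (star_mul_self_nonneg (v ()))
      convert this using 1
      simp [φ, dotProduct, Matrix.mulVec]
      ring) hS (fun i _ => v i)
    convert this using 1
    simp [φ, Ψ, dotProduct, Matrix.mulVec, Finset.mul_sum]
  have key := sum_dotProduct_nonneg hn hm Ψ hΨ hT fun k i => A (i, k) 0
  have h0 := congrArg (TensorProduct.lift K) (h 0 0)
  simp only [Matrix.of_apply, if_true, map_add, map_smul, TensorProduct.lift.tmul, hunit, map_sum,
    smul_eq_mul, mul_one] at h0
  rw [h0]
  convert key using 1
  simp only [Ψ, Fintype.sum_prod_type, dotProduct, Matrix.mulVec, Finset.mul_sum, LinearMap.coe_mk,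
    AddHom.coe_mk, Matrix.of_apply, Pi.star_apply]
  rw [Finset.sum_comm]
  refine Finset.sum_congr rfl fun k _ => ?_
  rw [Finset.sum_comm_cycle]
  refine Finset.sum_congr rfl fun l _ => Finset.sum_congr rfl fun i _ =>
    Finset.sum_congr rfl fun j _ => ?_
  ring

end cubeSystem

/-! ### The two inclusions -/

theorem Cqmax_subset (n m : ℕ) (hn : 0 < n) :
    Cqmax n m hn ⊆
      (fun (p : Fin m → Fin m → Fin n → Fin n → ℝ) a b x y => (p a b x y : ℂ)) '' Cnsb n m := by
  rintro c ⟨s, ⟨hs1, hs⟩, rfl⟩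
  have hpos := fun a b x y => hs _ (cubeSystem.gen_tmul_gen_mem_pos (m := m) hn a b x y)
  refine ⟨fun a b x y => (s (cubeSystem.gen hn a x ⊗ₜ[ℂ] cubeSystem.gen hn b y)).re,
    ⟨fun a b x y => (Complex.nonneg_iff.mp (hpos a b x y)).1, fun x y => ?_, fun b x x' y => ?_,
      fun a x y y' => ?_⟩, ?_⟩
  · simp only [← Complex.re_sum, ← map_sum, ← TensorProduct.tmul_sum, ← TensorProduct.sum_tmul,
      cubeSystem.sum_gen]
    exact congrArg Complex.re hs1
  · simp only [← Complex.re_sum, ← map_sum, ← TensorProduct.sum_tmul, cubeSystem.sum_gen]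
  · simp only [← Complex.re_sum, ← map_sum, ← TensorProduct.tmul_sum, cubeSystem.sum_gen]
  · funext a b x y
    exact Complex.ext rfl (Complex.nonneg_iff.mp (hpos a b x y)).2

theorem subset_Cqmax (n m : ℕ) (hn : 0 < n) (hm : 0 < m) :
    (fun (p : Fin m → Fin m → Fin n → Fin n → ℝ) a b x y => (p a b x y : ℂ)) '' Cnsb n m ⊆
      Cqmax n m hn := by
  rintro _ ⟨p, ⟨hp, hp1, hpA, hpB⟩, rfl⟩
  -- Each non-signalling condition makes one slot well defined: summing over `b` for the second,
  -- over `a` for the first.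
  choose φ hφ using fun a x => cubeSystem.exists_linearMap hn hm
    (fun b y => (p a b x y : ℂ)) fun y y' => by exact_mod_cast hpB a x y y'
  obtain ⟨K, hK⟩ := cubeSystem.exists_linearMap hn hm φ fun x x' =>
    cubeSystem.linearMap_ext hn fun b y => by
      simp only [LinearMap.sum_apply, hφ]; exact_mod_cast hpA b x x' y
  have hunit : K (cubeSystem n m hn).matrixOrder.unit (cubeSystem n m hn).matrixOrder.unit = 1 := by
    simp_rw [← cubeSystem.sum_gen hn ⟨0, hn⟩, map_sum, LinearMap.sum_apply, hK, hφ]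
    rw [Finset.sum_comm]
    exact_mod_cast hp1 _ _
  refine ⟨TensorProduct.lift K, ⟨hunit, fun v hv => cubeSystem.lift_nonneg hn hm K
    (fun a b x y => ?_) hunit hv⟩, ?_⟩
  · rw [hK, hφ]; exact_mod_cast hp a b x y
  · funext a b x y
    rw [TensorProduct.lift.tmul, hK, hφ]

theorem mainTheorem7 (n m : ℕ) (hn : 2 ≤ n) (hm : 2 ≤ m) :
    Cqmax n m (Nat.zero_lt_of_lt hn) =
      (fun (p : Fin m → Fin m → Fin n → Fin n → ℝ) a b x y => (p a b x y : ℂ)) '' Cnsb n m :=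
  (Cqmax_subset n m _).antisymm (subset_Cqmax n m _ (Nat.zero_lt_of_lt hm))
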